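/- Let $\pi$ be a recursive set of prime numbers, and let $\overline{\mathbf G}_\pi$ be the pseudovariety of all finite semigroups $S$ such that every subgroup of $S$ (a subsemigroup that is a group under the multiplication of $S$) is a $\pi$-group, i.e. all prime divisors of its order belong to $\pi$. A relational morphism $\varphi\colon T\to S$ of semigroups assigns to each $t\in T$ a nonempty subset $t\varphi\subseteq S$ such that $(t\varphi)(t'\varphi)\subseteq (tt')\varphi$ for all $t,t'\in T$. A subset $Z$ of a finite semigroup $T$ is $\overline{\mathbf G}_\pi$-pointlike if for every relational morphism $\varphi\colon T\to S$ with $S\in\overline{\mathbf G}_\pi$ there is $s\in S$ such that $s\in t\varphi$ for all $t\in Z$. Then the $\overline{\mathbf G}_\pi$-pointlike sets are decidable: there is an algorithm (depending only on $\pi$) that, given the multiplication table of a finite semigroup $T$ with respect to any enumeration of its elements, computes the list of all $\overline{\mathbf G}_\pi$-pointlike subsets of $T$ (each subset given as the increasing list of the indices of its elements). -/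

import Mathlib

/-- A relational morphism `φ : T → S` of semigroups, viewed as a map from `T` to subsets of `S`:
every `t φ` is nonempty, and `(t φ)(t' φ) ⊆ (t t') φ`. -/
structure IsRelationalMorphism {T S : Type*} [Semigroup T] [Semigroup S]
    (φ : T → Set S) : Prop where
  nonempty : ∀ t, (φ t).Nonempty
  mul_mem : ∀ t t' s s', s ∈ φ t → s' ∈ φ t' → s * s' ∈ φ (t * t')

/-- `Z ⊆ T` is `V`-pointlike, for a class `V` of finite semigroups (membership of `S` in the class
is `Finite S` together with `V S`): for every relational morphism `φ : T → S` with `S` in the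
class there is `s : S` with `Z ⊆ s φ⁻¹`. -/
def IsPointlike.{u} (V : ∀ (S : Type u) [Semigroup S], Prop) {T : Type u} [Semigroup T]
    (Z : Set T) : Prop :=
  ∀ (S : Type u) [Semigroup S] [Finite S], V S →
    ∀ φ : T → Set S, IsRelationalMorphism φ → ∃ s : S, Z ⊆ {t | s ∈ φ t}

/-- The subsemigroup `H` of `S` is a subgroup, that is, a group under the multiplication of `S`
(its identity `e` can be any idempotent of `S`). -/
def IsSubgroupOfSemigroup {S : Type*} [Semigroup S] (H : Subsemigroup S) : Prop :=
  ∃ e ∈ H, (∀ x ∈ H, e * x = x ∧ x * e = x) ∧ ∀ x ∈ H, ∃ y ∈ H, x * y = e ∧ y * x = e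

/-- All subgroups of the (finite) semigroup `S` are `π`-groups: every prime that divides the order
of a subgroup belongs to `π`. -/
def SubgroupsArePiGroups (π : Set ℕ) (S : Type*) [Semigroup S] : Prop :=
  ∀ H : Subsemigroup S, IsSubgroupOfSemigroup H → ∀ p : ℕ, p.Prime → p ∣ Nat.card H → p ∈ π

/-- The multiplication table of `T` with respect to an enumeration `e` of its elements by
`0, …, n - 1`: the list of its rows, the entry in row `i` and column `j` being the index of
`e i * e j`. -/
def mulTable {T : Type*} [Semigroup T] {n : ℕ} (e : Fin n ≃ T) : List (List ℕ) :=
  List.ofFn fun i => List.ofFn fun j => (e.symm (e i * e j) : ℕ)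

open Classical in
/-- A subset of `T` written as the increasing list of the indices of its elements. -/
noncomputable def indexList {T : Type*} {n : ℕ} (e : Fin n ≃ T) (Z : Set T) : List ℕ :=
  ((List.finRange n).filter fun i => e i ∈ Z).map Fin.val

/-!
The pointlike sets are exactly the subsets of the members of the smallest family of subsets of `T¹`
that contains the singletons `{t}`, `t ∈ T`, and is closed under products and under the operation
that sends `Z` to the union of all `Z ^ n`, where `n` runs over the large multiples of a number `D`.
Here `D` is a `π`-number that is divisible by every `π`-number up to the number of subsets of `T¹`,
so that this union absorbs the `π'`-part of the cyclic group at the end of the powers of `Z`.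

Every member of the family is pointlike. Indeed, if `s` is a common image of the elements of `Z`
in a semigroup all of whose subgroups are `π`-groups, then `s ^ n` is the same idempotent for all
large multiples `n` of some `π`-number `d`; by the Chinese remainder theorem every `Z ^ j` in the
union equals `Z ^ n` for such an `n`, so this idempotent is a common image of the whole union.

Conversely, adding `{1}` to the family gives a finite ordered monoid `M` in which the powers of each
element with exponents among the large multiples of `D` have a join that is compatible with
multiplication. By induction on `M` and on the size of the alphabet `A`, by means of local divisors,
every map `A → M` extends to a finite automaton whose states bound the values of the words that lead
to them, and in which no word permutes states in a cycle of prime length outside `π`. For the map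
`t ↦ {t}` the transition semigroup of this automaton has only `π`-subgroups, and the canonical
relational morphism to it sends every pointlike set into the bound of a single state.

A family of subsets of a finite set is closed under the two operations after at most as many rounds
as there are subsets, and every exponent above this number may be replaced by one in a finite
window, so the family is computable from the multiplication table.
-/

open scoped Pointwise

universe u

/-! ### Multiplicative joins -/

section MulJoin

variable {M : Type*} [Monoid M]

/-- `u` is the least upper bound of `S`, and stays so after multiplication of `S` and `u` by
arbitrary elements on both sides. -/
def IsMulJoin [LE M] (S : Set M) (u : M) : Prop :=
  ∀ x y z, x * u * y ≤ z ↔ ∀ s ∈ S, x * s * y ≤ z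

namespace IsMulJoin

variable {S S' : Set M} {u u' : M}

theorem singleton [LE M] (u : M) : IsMulJoin {u} u := by
  intro x y z
  simp

theorem mul [LE M] (h : IsMulJoin S u) (h' : IsMulJoin S' u') : IsMulJoin (S * S') (u * u') := by
  intro x y z
  calc x * (u * u') * y ≤ z
      ↔ x * u * (u' * y) ≤ z := by simp only [mul_assoc]
    _ ↔ ∀ s ∈ S, x * s * (u' * y) ≤ z := h x (u' * y) z
    _ ↔ ∀ s ∈ S, x * s * u' * y ≤ z := by simp only [mul_assoc]
    _ ↔ ∀ s ∈ S, ∀ s' ∈ S', x * s * s' * y ≤ z := forall₂_congr fun s _ => h' (x * s) y z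
    _ ↔ ∀ t ∈ S * S', x * t * y ≤ z := by
      simp only [← Set.image2_mul, Set.forall_mem_image2, mul_assoc]

theorem mul_le_mul [Preorder M] (h : IsMulJoin S u) {s : M} (hs : s ∈ S) (x y : M) :
    x * s * y ≤ x * u * y :=
  (h x y _).1 le_rfl s hs

theorem eq [PartialOrder M] (h : IsMulJoin S u) (h' : IsMulJoin S u') : u = u' := by
  refine eq_of_forall_ge_iff fun z => ?_
  simpa using (h 1 1 z).trans (h' 1 1 z).symm

end IsMulJoin

/-- The powers of each element of `M` with exponents in `J` have a multiplicative join. -/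
def HasPowerJoins (J : Set ℕ) (M : Type*) [Monoid M] [LE M] : Prop :=
  ∀ z : M, ∃ u, IsMulJoin ((z ^ ·) '' J) u

end MulJoin

/-! ### Local divisors -/

/-- The local divisor of `M` at `c` (Diekert and Kufleitner): the set `M c ∩ c M` with the product
`x c ∘ c y = x c y`, whose identity is `c`. -/
@[ext]
structure LocalDivisor {M : Type*} [Monoid M] (c : M) where
  val : M
  exists_eq_mul_right : ∃ x, val = x * c
  exists_eq_mul_left : ∃ y, val = c * y

namespace LocalDivisor

variable {M : Type*} [Monoid M] {c : M}

theorem val_injective : Function.Injective (val : LocalDivisor c → M) :=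
  fun _ _ => LocalDivisor.ext

noncomputable instance : Mul (LocalDivisor c) where
  mul p q :=
    { val := p.exists_eq_mul_right.choose * q.val
      exists_eq_mul_right := by
        obtain ⟨x, hx⟩ := q.exists_eq_mul_right
        exact ⟨p.exists_eq_mul_right.choose * x, by rw [hx, mul_assoc]⟩
      exists_eq_mul_left := by
        obtain ⟨y, hy⟩ := q.exists_eq_mul_left
        obtain ⟨y', hy'⟩ := p.exists_eq_mul_left
        refine ⟨y' * y, ?_⟩
        rw [hy, ← mul_assoc, ← p.exists_eq_mul_right.choose_spec, hy', mul_assoc] }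

instance : One (LocalDivisor c) where
  one := ⟨c, ⟨1, (one_mul c).symm⟩, ⟨1, (mul_one c).symm⟩⟩

theorem val_one : (1 : LocalDivisor c).val = c := rfl

theorem val_mul_of_right_eq {p q : LocalDivisor c} {y : M} (h : q.val = c * y) :
    (p * q).val = p.val * y := by
  change p.exists_eq_mul_right.choose * q.val = _
  rw [h, ← mul_assoc, ← p.exists_eq_mul_right.choose_spec]

theorem val_mul_of_left_eq {p q : LocalDivisor c} {x : M} (h : p.val = x * c) :
    (p * q).val = x * q.val := by
  obtain ⟨y, hy⟩ := q.exists_eq_mul_left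
  rw [val_mul_of_right_eq hy, h, hy, mul_assoc]

noncomputable instance : Monoid (LocalDivisor c) where
  mul_assoc p q r := by
    obtain ⟨x, hx⟩ := p.exists_eq_mul_right
    obtain ⟨y, hy⟩ := r.exists_eq_mul_left
    ext
    rw [val_mul_of_right_eq hy, val_mul_of_left_eq hx, val_mul_of_left_eq hx,
      val_mul_of_right_eq hy, mul_assoc]
  one_mul p := by
    ext
    rw [val_mul_of_left_eq (x := 1) (by rw [val_one, one_mul]), one_mul]
  mul_one p := by
    ext
    rw [val_mul_of_right_eq (y := 1) (by rw [val_one, mul_one]), mul_one]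

theorem val_pow_of_eq_mul_right {p : LocalDivisor c} {x : M} (h : p.val = x * c) (n : ℕ) :
    (p ^ n).val = x ^ n * c := by
  induction n with
  | zero => simp [val_one]
  | succ n ih => rw [pow_succ', val_mul_of_left_eq h, ih, pow_succ', mul_assoc]

theorem val_pow_of_eq_mul_left {p : LocalDivisor c} {y : M} (h : p.val = c * y) (n : ℕ) :
    (p ^ n).val = c * y ^ n := by
  induction n with
  | zero => simp [val_one]
  | succ n ih => rw [pow_succ, val_mul_of_right_eq h, ih, pow_succ, mul_assoc]

/-- The element `c m c` of the local divisor at `c`. -/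
def sandwich (c m : M) : LocalDivisor c where
  val := c * (m * c)
  exists_eq_mul_right := ⟨c * m, (mul_assoc _ _ _).symm⟩
  exists_eq_mul_left := ⟨m * c, rfl⟩

instance [PartialOrder M] : PartialOrder (LocalDivisor c) :=
  PartialOrder.lift val val_injective

theorem le_iff [PartialOrder M] {p q : LocalDivisor c} : p ≤ q ↔ p.val ≤ q.val := Iff.rfl

instance [PartialOrder M] [MulLeftMono M] : MulLeftMono (LocalDivisor c) where
  elim p q r h := by
    obtain ⟨x, hx⟩ := p.exists_eq_mul_right
    rw [le_iff, val_mul_of_left_eq hx, val_mul_of_left_eq hx]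
    exact mul_le_mul_right (le_iff.1 h) x

instance [Finite M] : Finite (LocalDivisor c) :=
  Finite.of_injective val val_injective

theorem card_lt [Finite M] (hc : ¬ IsUnit c) : Nat.card (LocalDivisor c) < Nat.card M := by
  rw [← Nat.card_range_of_injective val_injective, Nat.card_coe_set_eq]
  refine Set.ncard_lt_card fun h => ?_
  obtain ⟨⟨_, ⟨x, hx⟩, ⟨y, hy⟩⟩, rfl⟩ : 1 ∈ Set.range (val : LocalDivisor c → M) := h ▸ trivial
  exact hc (isUnit_iff_exists_and_exists.2 ⟨⟨y, hy.symm⟩, ⟨x, hx.symm⟩⟩)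

theorem isMulJoin_of_val [PartialOrder M] {S : Set (LocalDivisor c)} {w : LocalDivisor c}
    (h : IsMulJoin (val '' S) w.val) : IsMulJoin S w := by
  intro q r s
  obtain ⟨a, ha⟩ := q.exists_eq_mul_right
  obtain ⟨b, hb⟩ := r.exists_eq_mul_left
  have val_mul_mul (t : LocalDivisor c) : (q * t * r).val = a * t.val * b := by
    rw [val_mul_of_right_eq hb, val_mul_of_left_eq ha]
  rw [le_iff, val_mul_mul, h a b s.val, Set.forall_mem_image]
  simp only [le_iff, val_mul_mul]

theorem hasPowerJoins [PartialOrder M] {J : Set ℕ} (h : HasPowerJoins J M) :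
    HasPowerJoins J (LocalDivisor c) := by
  intro p
  obtain ⟨x, hx⟩ := p.exists_eq_mul_right
  obtain ⟨y, hy⟩ := p.exists_eq_mul_left
  obtain ⟨u, hu⟩ := h x
  obtain ⟨v, hv⟩ := h y
  have image_left : val '' ((p ^ ·) '' J) = (x ^ ·) '' J * {c} := by
    rw [Set.mul_singleton, Set.image_image, Set.image_image]
    exact Set.image_congr fun j _ => val_pow_of_eq_mul_right hx j
  have image_right : val '' ((p ^ ·) '' J) = {c} * (y ^ ·) '' J := by
    rw [Set.singleton_mul, Set.image_image, Set.image_image]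
    exact Set.image_congr fun j _ => val_pow_of_eq_mul_left hy j
  have join_left := image_left ▸ hu.mul (.singleton c)
  have join_right := image_right ▸ (IsMulJoin.singleton c).mul hv
  exact ⟨⟨u * c, ⟨u, rfl⟩, ⟨v, join_left.eq join_right⟩⟩, isMulJoin_of_val join_left⟩

end LocalDivisor

/-! ### Automata without cycles of prime length outside `π` -/

/-- `f` has no cycle whose length is a prime outside `π`. -/
def CycleFree (π : Set ℕ) {X : Type*} (f : X → X) : Prop :=
  ∀ p : ℕ, p.Prime → p ∉ π → ∀ x, Function.IsPeriodicPt f p x → Function.IsFixedPt f x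

namespace CycleFree

variable {π : Set ℕ} {X Y : Type*}

theorem comp_comm {f : X → Y} {g : Y → X} (h : CycleFree π (f ∘ g)) : CycleFree π (g ∘ f) := by
  intro p hp hpπ x hx
  have hsemi : Function.Semiconj f (g ∘ f) (f ∘ g) := fun _ => rfl
  have hfx : Function.IsFixedPt (f ∘ g) (f x) := h p hp hpπ _ (hx.map hsemi)
  exact hx.apply.eq_of_apply_eq_same hx hp.pos (congrArg g hfx)

theorem prodMap_id {f : X → X} (h : CycleFree π f) : CycleFree π (Prod.map (id : Y → Y) f) := by
  intro p hp hpπ x hx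
  rw [Function.isPeriodicPt_prodMap] at hx
  exact Prod.ext rfl (h p hp hpπ _ hx.2)

theorem mul_right {G : Type*} [Group G] {D : ℕ} (hD : ∀ p : ℕ, p.Prime → p ∉ π → p.Coprime D)
    {g : G} (hg : g ^ D = 1) : CycleFree π (· * g) := by
  intro p hp hpπ x hx
  have hgp : g ^ p = 1 := by
    simpa [Function.IsPeriodicPt, Function.IsFixedPt, mul_right_iterate] using hx
  have hg1 : g = 1 := orderOf_eq_one_iff.1 <| Nat.eq_one_of_dvd_coprimes (hD p hp hpπ)
    (orderOf_dvd_of_pow_eq_one hgp) (orderOf_dvd_of_pow_eq_one hg)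
  simp [Function.IsFixedPt, hg1]

end CycleFree

/-- A finite automaton over the alphabet `A` together with a labelling of its states such that the
label of the state reached by a word is an upper bound for the value of the word under `β`; no word
acts on the states with a cycle whose length is a prime outside `π`. -/
structure CycleFreeCover (π : Set ℕ) {A M : Type u} [Monoid M] [LE M] (β : A → M) where
  State : Type u
  finite : Finite State
  start : State
  step : State → A → State
  label : State → M
  one_le_label_start : 1 ≤ label start
  label_mul_le_label_step : ∀ x a, label x * β a ≤ label (step x a)
  cycleFree : ∀ w : List A, CycleFree π fun x => w.foldl step x

/-! ### Covers over the group of units -/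

/-- The exponents `D * n` with `k ≤ n`. The powers of an element of a finite group with these
exponents form a cyclic subgroup, whatever `k` is. -/
def largeMultiples (D k : ℕ) : Set ℕ :=
  (D * ·) '' Set.Ici k

theorem image_pow_largeMultiples {G : Type*} [Group G] [Finite G] (D k : ℕ) (g : G) :
    (g ^ ·) '' largeMultiples D k = Subgroup.zpowers (g ^ D) := by
  ext x
  rw [SetLike.mem_coe, ← mem_powers_iff_mem_zpowers, Submonoid.mem_powers_iff]
  simp only [largeMultiples, Set.image_image, pow_mul, Set.mem_image, Set.mem_Ici]
  constructor
  · rintro ⟨n, -, rfl⟩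
    exact ⟨n, rfl⟩
  · rintro ⟨n, rfl⟩
    refine ⟨n + orderOf (g ^ D) * k, ?_, by simp [pow_add, pow_mul (g ^ D), pow_orderOf_eq_one]⟩
    exact le_add_left (Nat.le_mul_of_pos_left k (orderOf_pos _))

theorem closure_induction_zpowers {G : Type*} [Group G] [Finite G] {P : Set G → Prop}
    (one : P {1}) (mul : ∀ S S', P S → P S' → P (S * S')) {s : Set G}
    (zpowers : ∀ g ∈ s, P (Subgroup.zpowers g)) : P (Subgroup.closure s) := by
  obtain ⟨S, ⟨hPS, h1S, hS⟩, hmax⟩ := Set.Finite.exists_maximal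
    (Set.toFinite {S : Set G | P S ∧ 1 ∈ S ∧ S ⊆ Subgroup.closure s})
    ⟨{1}, one, rfl, by simp⟩
  have mul_zpowers_subset (g) (hg : g ∈ s) : S * (Subgroup.zpowers g : Set G) ⊆ S := by
    have hgs : (Subgroup.zpowers g : Set G) ⊆ Subgroup.closure s :=
      Subgroup.zpowers_le.2 (Subgroup.subset_closure hg)
    refine hmax ⟨mul _ _ hPS (zpowers g hg), ⟨1, h1S, 1, one_mem _, mul_one 1⟩, ?_⟩ ?_
    · rintro _ ⟨a, ha, b, hb, rfl⟩
      exact mul_mem (hS ha) (hgs hb)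
    · exact fun a ha => ⟨a, ha, 1, one_mem _, mul_one a⟩
  have closure_subset : (Subgroup.closure s : Set G) ⊆ S := fun x hx => by
    induction hx using Subgroup.closure_induction_right with
    | one => exact h1S
    | mul_right x _ g hg hx =>
      exact mul_zpowers_subset g hg ⟨x, hx, g, Subgroup.mem_zpowers g, rfl⟩
    | mul_inv_cancel x _ g hg hx =>
      exact mul_zpowers_subset g hg ⟨x, hx, g⁻¹, inv_mem (Subgroup.mem_zpowers g), rfl⟩
  rwa [closure_subset.antisymm hS]

/-- The subgroup generated by all `D`-th powers. -/
def powSubgroup (G : Type*) [Group G] (D : ℕ) : Subgroup G :=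
  Subgroup.closure (Set.range (· ^ D))

section powSubgroup

variable (G : Type*) [Group G] (D : ℕ)

instance powSubgroup_normal : (powSubgroup G D).Normal := by
  refine ⟨fun n hn g => ?_⟩
  refine Subgroup.closure_induction (p := fun n _ => g * n * g⁻¹ ∈ powSubgroup G D) ?_ ?_ ?_ ?_ hn
  · rintro _ ⟨y, rfl⟩
    exact Subgroup.subset_closure ⟨g * y * g⁻¹, conj_pow⟩
  · simp [one_mem]
  · intro x y _ _ hx hy
    rw [← conj_mul]
    exact mul_mem hx hy
  · intro x _ hx
    rw [← conj_inv]
    exact inv_mem hx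

variable {G D}

theorem quotient_powSubgroup_pow_eq_one (x : G ⧸ powSubgroup G D) : x ^ D = 1 := by
  induction x using QuotientGroup.induction_on with
  | H g =>
    rw [← QuotientGroup.mk_pow, QuotientGroup.eq_one_iff]
    exact Subgroup.subset_closure ⟨g, rfl⟩

end powSubgroup

section UnitCover

variable {M : Type u} [Monoid M] [PartialOrder M]

theorem exists_isMulJoin_powSubgroup [Finite M] {D k : ℕ}
    (hM : HasPowerJoins (largeMultiples D k) M) :
    ∃ u : M, IsMulJoin (Units.val '' (powSubgroup Mˣ D : Set Mˣ)) u := by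
  refine closure_induction_zpowers (P := fun S => ∃ u : M, IsMulJoin (Units.val '' S) u) ?_ ?_ ?_
  · exact ⟨1, by simpa using IsMulJoin.singleton (1 : M)⟩
  · rintro S S' ⟨u, hu⟩ ⟨u', hu'⟩
    exact ⟨u * u', Set.image_mul (Units.coeHom M) ▸ hu.mul hu'⟩
  · rintro _ ⟨g, rfl⟩
    obtain ⟨u, hu⟩ := hM g
    refine ⟨u, ?_⟩
    rw [← image_pow_largeMultiples D k, Set.image_image]
    simpa only [Units.val_pow_eq_pow_val] using hu

variable {N : Subgroup Mˣ} {u : M}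

theorem units_mul_isMulJoin_le (hu : IsMulJoin (Units.val '' (N : Set Mˣ)) u) {g h : Mˣ}
    (hgh : h⁻¹ * g ∈ N) : (g : M) * u ≤ h * u := by
  have h₁ := (hu g 1 (h * u)).2
  rw [mul_one, Set.forall_mem_image] at h₁
  refine h₁ fun n hn => ?_
  simpa [mul_assoc] using hu.mul_le_mul (Set.mem_image_of_mem _ (mul_mem hgh hn)) (h : M) 1

theorem isMulJoin_mul_units_le [N.Normal] (hu : IsMulJoin (Units.val '' (N : Set Mˣ)) u)
    (x : M) (g : Mˣ) : x * u * g ≤ x * g * u := by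
  rw [hu, Set.forall_mem_image]
  intro n hn
  have hconj : g⁻¹ * n * g ∈ N := by
    simpa using ‹N.Normal›.conj_mem n hn g⁻¹
  simpa [mul_assoc] using hu.mul_le_mul (Set.mem_image_of_mem _ hconj) (x * g) 1

theorem foldl_mul_eq_mul_prod {A G : Type*} [Monoid G] (b : A → G) (w : List A) (x : G) :
    w.foldl (fun x a => x * b a) x = x * (w.map b).prod := by
  induction w generalizing x with
  | nil => simp
  | cons a w ih => simp [ih, mul_assoc]

theorem nonempty_cycleFreeCover_of_isUnit [Finite M] {π : Set ℕ} {D k : ℕ}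
    (hD : ∀ p : ℕ, p.Prime → p ∉ π → p.Coprime D)
    (hM : HasPowerJoins (largeMultiples D k) M) {A : Type u} {β : A → M}
    (hβ : ∀ a, IsUnit (β a)) : Nonempty (CycleFreeCover π β) := by
  choose b hb using hβ
  obtain ⟨u, hu⟩ := exists_isMulJoin_powSubgroup hM
  refine ⟨{
    State := Mˣ ⧸ powSubgroup Mˣ D
    finite := inferInstance
    start := 1
    step := fun x a => x * (b a : Mˣ ⧸ powSubgroup Mˣ D)
    label := Quotient.lift (fun g : Mˣ => g * u) fun g h hgh => ?_
    one_le_label_start := ?_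
    label_mul_le_label_step := ?_
    cycleFree := ?_ }⟩
  · have hmem : g⁻¹ * h ∈ powSubgroup Mˣ D := QuotientGroup.leftRel_apply.1 hgh
    have hmem' : h⁻¹ * g ∈ powSubgroup Mˣ D := by simpa using inv_mem hmem
    exact le_antisymm (units_mul_isMulJoin_le hu hmem') (units_mul_isMulJoin_le hu hmem)
  · change (1 : M) ≤ (1 : Mˣ) * u
    simpa using hu.mul_le_mul ⟨1, one_mem _, rfl⟩ 1 1
  · rintro ⟨g⟩ a
    change (g : M) * u * β a ≤ (g * b a : Mˣ) * u
    rw [← hb, Units.val_mul]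
    exact isMulJoin_mul_units_le hu g (b a)
  · intro w
    simp only [foldl_mul_eq_mul_prod]
    exact .mul_right hD (quotient_powSubgroup_pow_eq_one _)

end UnitCover

/-! ### Splitting words at a letter -/

section Split

variable {A X Y : Type*} (a : A) (x₀ : X) (stepX : X → {b // b ≠ a} → X) (y₀ : Y)
  (stepY : Y → X → Y)

open Classical in
/-- The automaton that runs `stepX` between consecutive occurrences of `a` and `stepY` on the
sequence of states in which these runs end. The second component of a state is the current state of
`stepX`; the first one is `none` before the first `a`, and then consists of the state in which the
first run ended and the current state of `stepY`, which does not read this first state. -/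
noncomputable def splitStep (s : Option (X × Y) × X) (b : A) : Option (X × Y) × X :=
  if h : b = a then (some (s.1.elim (s.2, y₀) fun q => (q.1, stepY q.2 s.2)), x₀)
  else (s.1, stepX s.2 ⟨b, h⟩)

theorem splitStep_self (s : Option (X × Y) × X) :
    splitStep a x₀ stepX y₀ stepY s a =
      (some (s.1.elim (s.2, y₀) fun q => (q.1, stepY q.2 s.2)), x₀) := by
  simp [splitStep]

theorem splitStep_of_ne {b : A} (h : b ≠ a) (s : Option (X × Y) × X) :
    splitStep a x₀ stepX y₀ stepY s b = (s.1, stepX s.2 ⟨b, h⟩) := by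
  simp [splitStep, h]

theorem exists_foldl_splitStep_of_notMem {w : List A} (hw : a ∉ w) :
    ∃ v : List {b // b ≠ a}, ∀ s, w.foldl (splitStep a x₀ stepX y₀ stepY) s =
      (s.1, v.foldl stepX s.2) := by
  induction w with
  | nil => exact ⟨[], fun _ => rfl⟩
  | cons b w ih =>
    rw [List.mem_cons, not_or] at hw
    obtain ⟨v, hv⟩ := ih hw.2
    refine ⟨⟨b, Ne.symm hw.1⟩ :: v, fun s => ?_⟩
    rw [List.foldl_cons, splitStep_of_ne a x₀ stepX y₀ stepY (Ne.symm hw.1), hv, List.foldl_cons]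

theorem exists_foldl_splitStep_some (w : List A) (x : X) :
    ∃ (v : List X) (x₁ : X), ∀ q : X × Y,
      w.foldl (splitStep a x₀ stepX y₀ stepY) (some q, x) =
        (some (q.1, v.foldl stepY q.2), x₁) := by
  induction w generalizing x with
  | nil => exact ⟨[], x, fun _ => rfl⟩
  | cons b w ih =>
    by_cases h : b = a
    · obtain ⟨v, x₁, hv⟩ := ih x₀
      refine ⟨x :: v, x₁, fun q => ?_⟩
      rw [List.foldl_cons, h, splitStep_self, Option.elim_some, hv, List.foldl_cons]
    · obtain ⟨v, x₁, hv⟩ := ih (stepX x ⟨b, h⟩)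
      refine ⟨v, x₁, fun q => ?_⟩
      rw [List.foldl_cons, splitStep_of_ne a x₀ stepX y₀ stepY h, hv]

variable {a x₀ stepX y₀ stepY} {π : Set ℕ}

theorem cycleFree_foldl_splitStep
    (hX : ∀ w : List {b // b ≠ a}, CycleFree π fun x => w.foldl stepX x)
    (hY : ∀ w : List X, CycleFree π fun y => w.foldl stepY y) (w : List A) :
    CycleFree π fun s => w.foldl (splitStep a x₀ stepX y₀ stepY) s := by
  set step := splitStep a x₀ stepX y₀ stepY with hstep
  by_cases hw : a ∈ w
  · -- A word containing `a` acts through `X × Y`, and the two halves of its action, composed in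
    -- the opposite order, act on `Y` like a word over `X`.
    obtain ⟨w₁, w₂, rfl⟩ := List.append_of_mem hw
    let read (s : Option (X × Y) × X) : X × Y :=
      s.1.elim (s.2, y₀) fun q => (q.1, stepY q.2 s.2)
    let enter (s : Option (X × Y) × X) : X × Y := read (w₁.foldl step s)
    let leave (q : X × Y) : Option (X × Y) × X := w₂.foldl step (some q, x₀)
    have foldl_eq : (fun s => (w₁ ++ a :: w₂).foldl step s) = leave ∘ enter := by
      funext s
      rw [List.foldl_append, List.foldl_cons, hstep, splitStep_self]
      rfl
    obtain ⟨v, x₁, hv⟩ := exists_foldl_splitStep_some a x₀ stepX y₀ stepY (w₂ ++ w₁) x₀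
    have enter_leave : enter ∘ leave = Prod.map id fun y => (v ++ [x₁]).foldl stepY y := by
      funext q
      change read (w₁.foldl step (w₂.foldl step (some q, x₀))) = _
      rw [← List.foldl_append, hstep, hv]
      simp [read, Prod.map]
    rw [foldl_eq]
    exact .comp_comm (enter_leave ▸ (hY _).prodMap_id)
  · obtain ⟨v, hv⟩ := exists_foldl_splitStep_of_notMem a x₀ stepX y₀ stepY hw
    simp only [hstep, hv]
    exact (hX v).prodMap_id

end Split

namespace CycleFreeCover

variable {π : Set ℕ} {A M : Type u} [Monoid M] [PartialOrder M] [MulLeftMono M] {β : A → M} {a : A}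

/-- The cover of `β` that evaluates a word `w₀ a w₁ a ⋯ a wₙ` by means of a cover of the words
`wᵢ`, in which `a` does not occur, and a cover over the local divisor at `β a` of the product of
the elements `β a * wᵢ * β a` with `0 < i < n`. -/
noncomputable def split (C : CycleFreeCover π fun b : {b // b ≠ a} => β b)
    (C' : CycleFreeCover π fun x : C.State => LocalDivisor.sandwich (β a) (C.label x)) :
    CycleFreeCover π β where
  State := Option (C.State × C'.State) × C.State
  finite := have := C.finite; have := C'.finite; inferInstance
  start := (none, C.start)
  step := splitStep a C.start C.step C'.start C'.step
  label s := (s.1.elim 1 fun q => C.label q.1 * (C'.label q.2).val) * C.label s.2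
  one_le_label_start := by simpa using C.one_le_label_start
  label_mul_le_label_step := by
    have le_mul_start (m : M) : m ≤ m * C.label C.start := by
      simpa using mul_le_mul_right C.one_le_label_start m
    rintro ⟨q, x⟩ b
    by_cases hb : b = a
    · subst hb
      rw [splitStep_self]
      refine le_trans ?_ (le_mul_start _)
      rcases q with _ | ⟨x', y⟩
      · simpa [LocalDivisor.val_one] using
          mul_le_mul_right (LocalDivisor.le_iff.1 C'.one_le_label_start) (C.label x)
      · have hy := LocalDivisor.le_iff.1 (C'.label_mul_le_label_step y x)
        rw [LocalDivisor.val_mul_of_right_eq rfl] at hy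
        simpa [mul_assoc] using mul_le_mul_right hy (C.label x')
    · rw [splitStep_of_ne _ _ _ _ _ hb, mul_assoc]
      exact mul_le_mul_right (C.label_mul_le_label_step x ⟨b, hb⟩) _
  cycleFree := cycleFree_foldl_splitStep C.cycleFree C'.cycleFree

end CycleFreeCover

theorem nonempty_cycleFreeCover {π : Set ℕ} {D k : ℕ}
    (hD : ∀ p : ℕ, p.Prime → p ∉ π → p.Coprime D) {A M : Type u} [Monoid M] [PartialOrder M]
    [MulLeftMono M] [Finite M] [Finite A] (hM : HasPowerJoins (largeMultiples D k) M)
    (β : A → M) : Nonempty (CycleFreeCover π β) := by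
  induction hm : Nat.card M using Nat.strong_induction_on generalizing M A with | _ m ihM
  induction hn : Nat.card A using Nat.strong_induction_on generalizing A with | _ n ihA
  by_cases h : ∀ a, IsUnit (β a)
  · exact nonempty_cycleFreeCover_of_isUnit hD hM h
  · push Not at h
    obtain ⟨a, ha⟩ := h
    have card_lt : Nat.card {b // b ≠ a} < n := hn ▸ Finite.card_subtype_lt (x := a) (by simp)
    obtain ⟨C⟩ := ihA _ card_lt (fun b : {b // b ≠ a} => β b) rfl
    have := C.finite
    obtain ⟨C'⟩ := ihM _ (hm ▸ LocalDivisor.card_lt ha) (LocalDivisor.hasPowerJoins hM)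
      (fun x => LocalDivisor.sandwich (β a) (C.label x)) rfl
    exact ⟨C.split C'⟩

/-! ### Subgroups of finite semigroups -/

theorem mulHom_map_pow {M P : Type*} [Monoid M] [Monoid P] (f : M →ₙ* P) (x : M) {n : ℕ}
    (hn : n ≠ 0) : f (x ^ n) = f x ^ n := by
  induction n, Nat.one_le_iff_ne_zero.2 hn using Nat.le_induction with
  | base => simp
  | succ n _ ih => rw [pow_succ, map_mul, ih (by omega), pow_succ]

namespace IsSubgroupOfSemigroup

variable {S P : Type*} [Semigroup S] [Monoid P] {H : Subsemigroup S}

/-- The group structure on a subgroup of a semigroup, extending its semigroup structure. -/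
@[reducible]
noncomputable def toGroup (h : IsSubgroupOfSemigroup H) : Group H :=
  { (inferInstance : Semigroup H) with
    one := ⟨h.choose, h.choose_spec.1⟩
    one_mul x := Subtype.ext (h.choose_spec.2.1 x x.2).1
    mul_one x := Subtype.ext (h.choose_spec.2.1 x x.2).2
    inv x := ⟨(h.choose_spec.2.2 x x.2).choose, (h.choose_spec.2.2 x x.2).choose_spec.1⟩
    inv_mul_cancel x := Subtype.ext (h.choose_spec.2.2 x x.2).choose_spec.2.2 }

theorem map_pow_card [Finite S] (h : IsSubgroupOfSemigroup H) (f : S →ₙ* P) {x e : S}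
    (hx : x ∈ H) (he : e ∈ H) (hee : IsIdempotentElem e) : f x ^ Nat.card H = f e := by
  let _ := h.toGroup
  have e_mul_e : (⟨e, he⟩ : H) * ⟨e, he⟩ = ⟨e, he⟩ := Subtype.ext hee
  have e_eq_one : (⟨e, he⟩ : H) = 1 := mul_eq_left.1 e_mul_e
  have pow_card : (⟨x, hx⟩ : H) ^ Nat.card H = ⟨e, he⟩ := e_eq_one ▸ pow_card_eq_one'
  have := congrArg (f.comp (MulMemClass.subtype H)) pow_card
  rwa [mulHom_map_pow _ _ Nat.card_pos.ne'] at this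

theorem exists_map_pow_prime_eq [Finite S] (h : IsSubgroupOfSemigroup H) (f : S →ₙ* P) {p : ℕ}
    (hp : p.Prime) (hpH : p ∣ Nat.card H) :
    ∃ x e : S, IsIdempotentElem e ∧ e * x = x ∧ x ≠ e ∧ f x ^ p = f e := by
  let _ := h.toGroup
  have : Fact p.Prime := ⟨hp⟩
  obtain ⟨x, hx⟩ := exists_prime_orderOf_dvd_card' p hpH
  refine ⟨x, (1 : H), congrArg Subtype.val (one_mul (1 : H)), congrArg Subtype.val (one_mul x),
    fun hx1 => hp.ne_one ?_, ?_⟩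
  · rw [← hx, orderOf_eq_one_iff]
    exact Subtype.ext hx1
  · have pow_eq_one : x ^ p = 1 := hx ▸ pow_orderOf_eq_one x
    have := congrArg (f.comp (MulMemClass.subtype H)) pow_eq_one
    rwa [mulHom_map_pow _ _ hp.ne_zero] at this

end IsSubgroupOfSemigroup

/-- The group of units of `e S e`, which for an idempotent `e` is the maximal subgroup of `S` with
identity `e`. -/
def maximalSubgroup {S : Type*} [Semigroup S] (e : S) : Subsemigroup S where
  carrier := {x | (e * x = x ∧ x * e = x) ∧ ∃ y, x * y = e ∧ y * x = e}
  mul_mem' := by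
    rintro x x' ⟨⟨hx, hx'⟩, y, hxy, hyx⟩ ⟨⟨hz, hz'⟩, y', hxy', hyx'⟩
    refine ⟨⟨by rw [← mul_assoc, hx], by rw [mul_assoc, hz']⟩, y' * y, ?_, ?_⟩
    · rw [mul_assoc, ← mul_assoc x', hxy', ← mul_assoc, hx', hxy]
    · rw [mul_assoc, ← mul_assoc y, hyx, hz, hyx']

theorem isSubgroupOfSemigroup_maximalSubgroup {S : Type*} [Semigroup S] {e : S}
    (he : IsIdempotentElem e) : IsSubgroupOfSemigroup (maximalSubgroup e) := by
  refine ⟨e, ⟨⟨he, he⟩, e, he, he⟩, fun _ hx => hx.1, ?_⟩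
  rintro x ⟨⟨hx, hx'⟩, y, hxy, hyx⟩
  have mul_inv : x * (e * (y * e)) = e := by rw [← mul_assoc, hx', ← mul_assoc, hxy, he]
  have inv_mul : e * (y * e) * x = e := by rw [mul_assoc, mul_assoc, hx, hyx, he]
  refine ⟨e * (y * e), ⟨⟨?_, ?_⟩, x, inv_mul, mul_inv⟩, mul_inv, inv_mul⟩
  · rw [← mul_assoc, he]
  · rw [mul_assoc, mul_assoc, he]

/-! ### Powers in finite monoids -/

instance finite_withOne {S : Type*} [Finite S] : Finite (WithOne S) :=
  inferInstanceAs (Finite (Option S))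

section Powers

variable {P : Type*} [Monoid P]

theorem exists_pow_add_eq_pow [Finite P] (z : P) :
    ∃ i m, m ≠ 0 ∧ i + m ≤ Nat.card P ∧ z ^ (i + m) = z ^ i := by
  have := Fintype.ofFinite P
  obtain ⟨i, j, hne, heq⟩ := Fintype.exists_ne_map_eq_of_card_lt
    (fun i : Fin (Nat.card P + 1) => z ^ (i : ℕ)) (by simp [Nat.card_eq_fintype_card])
  wlog hij : i < j generalizing i j
  · exact this j i hne.symm heq.symm (lt_of_le_of_ne (not_lt.1 hij) hne.symm)
  have add_sub : (i : ℕ) + (j - i) = j := Nat.add_sub_cancel' hij.le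
  exact ⟨i, j - i, Nat.sub_ne_zero_of_lt hij, by omega, by rw [add_sub]; exact heq.symm⟩

theorem pow_eq_pow_of_le_of_modEq {z : P} {i m j n : ℕ} (h : z ^ (i + m) = z ^ i) (hj : i ≤ j)
    (hn : i ≤ n) (hmod : j ≡ n [MOD m]) : z ^ j = z ^ n := by
  have pow_add_mul (q : ℕ) {l : ℕ} (hl : i ≤ l) : z ^ (l + m * q) = z ^ l := by
    induction q with
    | zero => simp
    | succ q ih =>
      obtain ⟨l, rfl⟩ := Nat.exists_eq_add_of_le hl
      rw [← ih, show i + l + m * (q + 1) = i + m + (l + m * q) by ring, pow_add, h, ← pow_add,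
        add_assoc]
  wlog hjn : j ≤ n generalizing j n
  · exact (this hn hj hmod.symm (le_of_not_ge hjn)).symm
  obtain ⟨q, hq⟩ := (Nat.modEq_iff_dvd' hjn).1 hmod
  rw [← pow_add_mul q hj, ← hq, Nat.add_sub_cancel' hjn]

theorem exists_isIdempotentElem_pow [Finite P] (z : P) : ∃ a, a ≠ 0 ∧ IsIdempotentElem (z ^ a) := by
  obtain ⟨i, m, hm, -, h⟩ := exists_pow_add_eq_pow z
  have hi : i ≤ m * (i + 1) := by nlinarith [Nat.one_le_iff_ne_zero.2 hm]
  refine ⟨m * (i + 1), by simp [hm], ?_⟩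
  rw [IsIdempotentElem, ← pow_add]
  exact pow_eq_pow_of_le_of_modEq h (by omega) hi (by simp [Nat.ModEq])

end Powers

theorem exists_coe_eq_coe_pow {S : Type*} [Semigroup S] (s : S) {n : ℕ} (hn : n ≠ 0) :
    ∃ x : S, (x : WithOne S) = (s : WithOne S) ^ n := by
  induction n, Nat.one_le_iff_ne_zero.2 hn using Nat.le_induction with
  | base => exact ⟨s, by simp⟩
  | succ n _ ih =>
    obtain ⟨y, hy⟩ := ih (by omega)
    exact ⟨y * s, by rw [pow_succ, ← hy, WithOne.coe_mul]⟩

theorem SubgroupsArePiGroups.exists_pow_eq {π : Set ℕ} {S : Type*} [Semigroup S] [Finite S]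
    (h : SubgroupsArePiGroups π S) (s : S) :
    ∃ (d a : ℕ) (e : S), d ≠ 0 ∧ (∀ p : ℕ, p.Prime → p ∣ d → p ∈ π) ∧
      ∀ n, a ≤ n → d ∣ n → (s : WithOne S) ^ n = e := by
  obtain ⟨a, ha, hidem⟩ := exists_isIdempotentElem_pow (s : WithOne S)
  obtain ⟨e, he⟩ := exists_coe_eq_coe_pow s ha
  obtain ⟨x, hx⟩ := exists_coe_eq_coe_pow s (n := a + 1) (by omega)
  obtain ⟨y, hy⟩ := exists_coe_eq_coe_pow s (n := 2 * a - 1) (by omega)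
  set z : WithOne S := (s : WithOne S)
  have pow_add_left {n : ℕ} (hn : a ≤ n) : z ^ (a + n) = z ^ n := by
    obtain ⟨l, rfl⟩ := Nat.exists_eq_add_of_le hn
    rw [pow_add z a, pow_add z a, ← mul_assoc, hidem.eq]
  have pow_three : z ^ (a + 2 * a) = z ^ a := by
    rw [pow_add_left (by omega), two_mul, pow_add_left le_rfl]
  have hee : IsIdempotentElem e := WithOne.coe_injective (by rw [WithOne.coe_mul, he, hidem.eq])
  have hxH : x ∈ maximalSubgroup e := by
    refine ⟨⟨?_, ?_⟩, y, ?_, ?_⟩ <;> apply WithOne.coe_injective <;>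
      simp only [WithOne.coe_mul, he, hx, hy, ← pow_add]
    · exact pow_add_left (by omega)
    · rw [add_comm, pow_add_left (by omega)]
    · rw [show a + 1 + (2 * a - 1) = a + 2 * a by omega, pow_three]
    · rw [show 2 * a - 1 + (a + 1) = a + 2 * a by omega, pow_three]
  set d := Nat.card (maximalSubgroup e)
  have hH := isSubgroupOfSemigroup_maximalSubgroup hee
  have pow_card : (z ^ (a + 1)) ^ d = z ^ a := by
    rw [← hx, ← he]
    exact hH.map_pow_card WithOne.coeMulHom hxH ⟨⟨hee, hee⟩, e, hee, hee⟩ hee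
  have : Nonempty (maximalSubgroup e) := ⟨⟨x, hxH⟩⟩
  refine ⟨d, a, e, Nat.card_pos.ne', h _ hH, ?_⟩
  rintro n hn ⟨q, rfl⟩
  have hdq : d * q ≠ 0 := by omega
  calc z ^ (d * q)
      = z ^ (a + d * q) := (pow_add_left hn).symm
    _ = (z ^ (a + 1)) ^ (d * q) := by
      rw [← pow_mul, add_mul, one_mul, pow_add, pow_add, pow_mul z a, hidem.pow_eq hdq]
    _ = e := by rw [pow_mul, pow_card, hidem.pow_eq (right_ne_zero_of_mul hdq), he]

/-! ### Transition semigroups -/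

section Transition

variable {A X : Type*}

/-- The action of nonempty words on the states of an automaton. It takes values in the opposite of
the endomorphism monoid because the first letter of a word acts first. -/
def transition (step : X → A → X) : FreeSemigroup A →ₙ* (Function.End X)ᵐᵒᵖ :=
  FreeSemigroup.lift fun a => .op fun x => step x a

theorem unop_transition_of (step : X → A → X) (a : A) (x : X) :
    (transition step (.of a)).unop x = step x a := rfl

theorem unop_transition_mul (step : X → A → X) (v w : FreeSemigroup A) (x : X) :
    (transition step (v * w)).unop x = (transition step w).unop ((transition step v).unop x) := by
  rw [map_mul]
  rfl

theorem exists_unop_transition_eq_foldl (step : X → A → X) (w : FreeSemigroup A) :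
    ∃ v : List A, (transition step w).unop = fun x => v.foldl step x := by
  induction w using FreeSemigroup.recOnMul with
  | ih1 a => exact ⟨[a], rfl⟩
  | ih2 a w _ hw =>
    obtain ⟨v, hv⟩ := hw
    refine ⟨a :: v, funext fun x => ?_⟩
    rw [unop_transition_mul, unop_transition_of, hv, List.foldl_cons]

instance finite_op_end [Finite X] : Finite (Function.End X)ᵐᵒᵖ :=
  Finite.of_equiv (X → X) MulOpposite.opEquiv

theorem subgroupsArePiGroups_of_cycleFree {π : Set ℕ} [Finite X]
    {S : Subsemigroup (Function.End X)ᵐᵒᵖ} (h : ∀ f ∈ S, CycleFree π (f.unop : X → X)) :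
    SubgroupsArePiGroups π S := by
  intro H hH p hp hpH
  by_contra hpπ
  obtain ⟨f, e, e_mul_e, e_mul_f, f_ne_e, pow_eq⟩ :=
    hH.exists_map_pow_prime_eq (MulMemClass.subtype S) hp hpH
  have iterate_eq : (f.1.unop : X → X)^[p] = e.1.unop := by
    rw [← hom_coe_pow (fun g : Function.End X => (g : X → X)) rfl (fun _ _ => rfl)]
    exact congrArg MulOpposite.unop pow_eq
  have e_e (x : X) : e.1.unop (e.1.unop x) = e.1.unop x :=
    congrFun (congrArg (fun g : S => g.1.unop) e_mul_e.eq) x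
  have f_e (x : X) : f.1.unop (e.1.unop x) = f.1.unop x :=
    congrFun (congrArg (fun g : S => g.1.unop) e_mul_f) x
  refine f_ne_e (Subtype.ext (MulOpposite.unop_injective (funext fun x => ?_)))
  have isPeriodicPt : Function.IsPeriodicPt (f.1.unop : X → X) p (e.1.unop x) :=
    (congrFun iterate_eq _).trans (e_e x)
  rw [← f_e x]
  exact h f f.2 p hp hpπ _ isPeriodicPt

theorem isRelationalMorphism_image_preimage {F S T : Type*} [Mul F] [Semigroup S] [Semigroup T]
    {f : F →ₙ* T} (hf : Function.Surjective f) (g : F →ₙ* S) :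
    IsRelationalMorphism fun t => g '' (f ⁻¹' {t}) where
  nonempty t := ((Set.singleton_nonempty t).preimage hf).image g
  mul_mem := by
    rintro _ _ _ _ ⟨v, rfl, rfl⟩ ⟨w, rfl, rfl⟩
    exact ⟨v * w, map_mul f v w, map_mul g v w⟩

end Transition

namespace CycleFreeCover

variable {π : Set ℕ} {A M : Type u} [Monoid M] {β : A → M}

theorem subgroupsArePiGroups_srange_transition [LE M] (C : CycleFreeCover π β) :
    SubgroupsArePiGroups π (transition C.step).srange := by
  have := C.finite
  refine subgroupsArePiGroups_of_cycleFree ?_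
  rintro _ ⟨w, rfl⟩
  obtain ⟨v, hv⟩ := exists_unop_transition_eq_foldl C.step w
  exact hv ▸ C.cycleFree v

variable [Preorder M] [MulRightMono M]

theorem label_mul_lift_le (C : CycleFreeCover π β) (w : FreeSemigroup A) (x : C.State) :
    C.label x * FreeSemigroup.lift β w ≤ C.label ((transition C.step w).unop x) := by
  induction w using FreeSemigroup.recOnMul generalizing x with
  | ih1 a => exact C.label_mul_le_label_step x a
  | ih2 a w _ hw =>
    rw [map_mul, ← mul_assoc, FreeSemigroup.lift_of, unop_transition_mul, unop_transition_of]
    exact (mul_le_mul_left (C.label_mul_le_label_step x a) _).trans (hw _)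

theorem lift_le_label (C : CycleFreeCover π β) (w : FreeSemigroup A) :
    FreeSemigroup.lift β w ≤ C.label ((transition C.step w).unop C.start) :=
  (le_mul_of_one_le_left' C.one_le_label_start).trans (C.label_mul_lift_le w C.start)

end CycleFreeCover

theorem IsPointlike.exists_forall_mem_lift_le_label {π : Set ℕ} {T M : Type u} [Semigroup T]
    [Monoid M] [Preorder M] [MulRightMono M] {Z : Set T}
    (hZ : IsPointlike (fun S _ => SubgroupsArePiGroups π S) Z) {β : T → M}
    (C : CycleFreeCover π β) :
    ∃ x, (∃ w, FreeSemigroup.lift β w ≤ C.label x) ∧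
      ∀ t ∈ Z, ∃ w, FreeSemigroup.lift id w = t ∧ FreeSemigroup.lift β w ≤ C.label x := by
  have := C.finite
  have surjective : Function.Surjective (FreeSemigroup.lift (id : T → T)) :=
    fun t => ⟨.of t, FreeSemigroup.lift_of _ t⟩
  obtain ⟨⟨_, w, rfl⟩, hw⟩ := hZ (transition C.step).srange
    C.subgroupsArePiGroups_srange_transition _
    (isRelationalMorphism_image_preimage surjective (transition C.step).srangeRestrict)
  refine ⟨_, ⟨w, C.lift_le_label w⟩, fun t ht => ?_⟩
  obtain ⟨v, hvt, hvw⟩ := hw ht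
  refine ⟨v, hvt, (C.lift_le_label v).trans_eq ?_⟩
  rw [show transition C.step v = transition C.step w from congrArg Subtype.val hvw]

/-! ### Exponents -/

/-- A product of primes of `π` that is divisible by all numbers up to `k` whose prime divisors
belong to `π`. -/
def piExponent (π : Set ℕ) [DecidablePred (· ∈ π)] (k : ℕ) : ℕ :=
  ∏ p ∈ (Finset.range (k + 1)).filter (· ∈ π), p ^ k

section PiExponent

variable {π : Set ℕ} [DecidablePred (· ∈ π)]

theorem coprime_piExponent (hπ : ∀ p ∈ π, p.Prime) (k : ℕ) {p : ℕ} (hp : p.Prime) (hpπ : p ∉ π) :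
    p.Coprime (piExponent π k) := by
  refine Nat.Coprime.prod_right fun q hq => Nat.Coprime.pow_right _ ?_
  have hq := (Finset.mem_filter.1 hq).2
  exact (Nat.coprime_primes hp (hπ q hq)).2 fun h => hpπ (h ▸ hq)

theorem piExponent_ne_zero (hπ : ∀ p ∈ π, p.Prime) (k : ℕ) : piExponent π k ≠ 0 :=
  Finset.prod_ne_zero_iff.2 fun q hq => pow_ne_zero _ (hπ q (Finset.mem_filter.1 hq).2).ne_zero

theorem dvd_piExponent {g k : ℕ} (hg : g ≠ 0) (hgk : g ≤ k)
    (h : ∀ p : ℕ, p.Prime → p ∣ g → p ∈ π) : g ∣ piExponent π k := by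
  calc g
      = ∏ p ∈ g.primeFactors, p ^ g.factorization p := (Nat.prod_factorization_pow_eq_self hg).symm
    _ ∣ ∏ p ∈ g.primeFactors, p ^ k := Finset.prod_dvd_prod_of_dvd _ _ fun p _ =>
      pow_dvd_pow p ((Nat.factorization_lt p hg).le.trans hgk)
    _ ∣ piExponent π k := Finset.prod_dvd_prod_of_subset _ _ _ fun p hp => by
      have hpg := Nat.dvd_of_mem_primeFactors hp
      have hpk : p ≤ k := (Nat.le_of_dvd (Nat.pos_of_ne_zero hg) hpg).trans hgk
      simp [Nat.lt_succ_of_le hpk, h p (Nat.prime_of_mem_primeFactors hp) hpg]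

end PiExponent

section Powers

variable {P : Type*} [Monoid P]

theorem exists_dvd_pow_eq_pow {z : P} {i m j d : ℕ} (a : ℕ) (hm : m ≠ 0) (hd : d ≠ 0)
    (h : z ^ (i + m) = z ^ i) (hj : i ≤ j) (hgcd : m.gcd d ∣ j) :
    ∃ n, a ≤ n ∧ d ∣ n ∧ z ^ n = z ^ j := by
  obtain ⟨n, hnj, hn0⟩ := Nat.chineseRemainder' (Nat.modEq_zero_iff_dvd.2 hgcd)
  have hle : j + a ≤ m * d * (j + a) := Nat.le_mul_of_pos_left _ (by positivity)
  refine ⟨n + m * d * (j + a), by omega, ?_, ?_⟩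
  · rw [mul_comm m, mul_assoc]
    exact dvd_add (Nat.modEq_zero_iff_dvd.1 hn0) (dvd_mul_right _ _)
  · refine pow_eq_pow_of_le_of_modEq h (by omega) hj (.trans ?_ hnj)
    simp [Nat.ModEq, mul_assoc]

theorem exists_pow_eq_of_mem_largeMultiples [Finite P] {π : Set ℕ} [DecidablePred (· ∈ π)]
    (hπ : ∀ p ∈ π, p.Prime) {k : ℕ} (hk : Nat.card P ≤ k) (z : P) {j : ℕ}
    (hj : j ∈ largeMultiples (piExponent π k) k) {d : ℕ} (a : ℕ) (hd : d ≠ 0)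
    (hdπ : ∀ p : ℕ, p.Prime → p ∣ d → p ∈ π) : ∃ n, a ≤ n ∧ d ∣ n ∧ z ^ n = z ^ j := by
  obtain ⟨i, m, hm, him, h⟩ := exists_pow_add_eq_pow z
  obtain ⟨l, hl, rfl⟩ := hj
  have hlj : l ≤ piExponent π k * l :=
    Nat.le_mul_of_pos_left l (Nat.pos_of_ne_zero (piExponent_ne_zero hπ k))
  have hgk : m.gcd d ≤ k := (Nat.gcd_le_left d (Nat.pos_of_ne_zero hm)).trans (by omega)
  have hgcd : m.gcd d ∣ piExponent π k := dvd_piExponent (Nat.gcd_ne_zero_left hm) hgk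
    fun p hp hpd => hdπ p hp (hpd.trans (Nat.gcd_dvd_right m d))
  rw [Set.mem_Ici] at hl
  exact exists_dvd_pow_eq_pow a hm hd h ((by omega : i ≤ l).trans hlj) (hgcd.mul_right l)

theorem image_pow_largeMultiples_eq_image_Iio [Finite P] {k : ℕ} (hk : Nat.card P ≤ k) (D : ℕ)
    (z : P) : (z ^ ·) '' largeMultiples D k = (fun i => z ^ (D * (k + i))) '' Set.Iio k := by
  rw [largeMultiples, Set.image_image]
  apply Set.Subset.antisymm
  · rintro _ ⟨n, hn, rfl⟩
    obtain ⟨i, m, hm, him, h⟩ := exists_pow_add_eq_pow (z ^ D)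
    have hlt : (n - k) % m < m := Nat.mod_lt _ (Nat.pos_of_ne_zero hm)
    refine ⟨(n - k) % m, by simp; omega, ?_⟩
    simp only [pow_mul]
    rw [Set.mem_Ici] at hn
    refine pow_eq_pow_of_le_of_modEq h (by omega) (by omega) ?_
    conv_rhs => rw [← Nat.add_sub_cancel' hn]
    exact (Nat.mod_modEq _ _).add_left k
  · rintro _ ⟨i, -, rfl⟩
    exact ⟨k + i, Nat.le_add_right k i, rfl⟩

end Powers

/-! ### Pointlike sets -/

/-- The smallest family of subsets of `T` with an identity adjoined that contains the singletons of
elements of `T` and is closed under products and under unions of the powers with exponents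
in `J`. -/
inductive PowerSaturation {T : Type*} [Semigroup T] (J : Set ℕ) : Set (WithOne T) → Prop
  | singleton (t : T) : PowerSaturation J {(t : WithOne T)}
  | mul {Y Z : Set (WithOne T)} :
      PowerSaturation J Y → PowerSaturation J Z → PowerSaturation J (Y * Z)
  | biUnion_pow {Z : Set (WithOne T)} :
      PowerSaturation J Z → PowerSaturation J (⋃ j ∈ J, Z ^ j)

namespace IsRelationalMorphism

variable {T S : Type*} [Semigroup T] [Semigroup S] {φ : T → Set S}

/-- The graph of a relational morphism, extended to the semigroups with adjoined identities. -/
def graph (hφ : IsRelationalMorphism φ) : Submonoid (WithOne T × WithOne S) where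
  carrier := {q | q = 1 ∨ ∃ t s, s ∈ φ t ∧ q = ((t : WithOne T), (s : WithOne S))}
  one_mem' := Or.inl rfl
  mul_mem' := by
    rintro _ _ (rfl | ⟨t, s, hs, rfl⟩) (rfl | ⟨t', s', hs', rfl⟩)
    · simp
    · exact Or.inr ⟨t', s', hs', one_mul _⟩
    · exact Or.inr ⟨t, s, hs, mul_one _⟩
    · exact Or.inr ⟨t * t', s * s', hφ.mul_mem t t' s s' hs hs', rfl⟩

theorem coe_mem_graph (hφ : IsRelationalMorphism φ) {t : T} {s : S} :
    ((t : WithOne T), (s : WithOne S)) ∈ hφ.graph ↔ s ∈ φ t := by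
  constructor
  · rintro (h | ⟨t', s', hs', h⟩)
    · exact absurd (congrArg Prod.fst h) WithOne.coe_ne_one
    · obtain ⟨rfl, rfl⟩ : t = t' ∧ s = s' := by simpa using h
      exact hs'
  · exact fun hs => Or.inr ⟨t, s, hs, rfl⟩

theorem pow_mem_graph (hφ : IsRelationalMorphism φ) {Z : Set (WithOne T)} {y : WithOne S}
    (hZ : ∀ x ∈ Z, (x, y) ∈ hφ.graph) (n : ℕ) : ∀ x ∈ Z ^ n, (x, y ^ n) ∈ hφ.graph := by
  induction n with
  | zero =>
    rintro _ rfl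
    exact one_mem hφ.graph
  | succ n ih =>
    rw [pow_succ, pow_succ]
    rintro _ ⟨x, hx, x', hx', rfl⟩
    exact hφ.graph.mul_mem (ih x hx) (hZ x' hx')

end IsRelationalMorphism

namespace PowerSaturation

variable {π : Set ℕ} [DecidablePred (· ∈ π)]

theorem exists_forall_mem_graph {T S : Type*} [Semigroup T] [Finite T] [Semigroup S] [Finite S]
    (hπ : ∀ p ∈ π, p.Prime) {k : ℕ} (hk : Nat.card (Set (WithOne T)) ≤ k)
    (hS : SubgroupsArePiGroups π S) {φ : T → Set S} (hφ : IsRelationalMorphism φ)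
    {Y : Set (WithOne T)} (hY : PowerSaturation (largeMultiples (piExponent π k) k) Y) :
    ∃ s : S, ∀ x ∈ Y, (x, (s : WithOne S)) ∈ hφ.graph := by
  induction hY with
  | singleton t =>
    obtain ⟨s, hs⟩ := hφ.nonempty t
    refine ⟨s, ?_⟩
    rintro _ rfl
    exact hφ.coe_mem_graph.2 hs
  | mul _ _ ihY ihZ =>
    obtain ⟨s, hs⟩ := ihY
    obtain ⟨s', hs'⟩ := ihZ
    refine ⟨s * s', ?_⟩
    rintro _ ⟨x, hx, x', hx', rfl⟩
    exact mul_mem (hs x hx) (hs' x' hx')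
  | biUnion_pow _ ih =>
    obtain ⟨s, hs⟩ := ih
    obtain ⟨d, a, e, hd, hdπ, pow_eq⟩ := hS.exists_pow_eq s
    refine ⟨e, fun x hx => ?_⟩
    obtain ⟨j, hj, hxj⟩ := Set.mem_iUnion₂.1 hx
    obtain ⟨n, han, hdn, hn⟩ := exists_pow_eq_of_mem_largeMultiples hπ hk _ hj a hd hdπ
    rw [← pow_eq n han hdn]
    exact hφ.pow_mem_graph hs n x (hn ▸ hxj)

theorem isPointlike {T : Type u} [Semigroup T] [Finite T] (hπ : ∀ p ∈ π, p.Prime) {k : ℕ}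
    (hk : Nat.card (Set (WithOne T)) ≤ k) {Y : Set (WithOne T)}
    (hY : PowerSaturation (largeMultiples (piExponent π k) k) Y) {Z : Set T}
    (hZ : ∀ t ∈ Z, (t : WithOne T) ∈ Y) :
    IsPointlike (fun S _ => SubgroupsArePiGroups π S) Z := by
  intro S _ _ hS φ hφ
  obtain ⟨s, hs⟩ := hY.exists_forall_mem_graph hπ hk hS hφ
  exact ⟨s, fun t ht => hφ.coe_mem_graph.1 (hs t (hZ t ht))⟩

/-- The members of `PowerSaturation J`, together with `{1}`. -/
def submonoid (T : Type*) [Semigroup T] (J : Set ℕ) : Submonoid (Set (WithOne T)) where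
  carrier := {Y | Y = 1 ∨ PowerSaturation J Y}
  one_mem' := Or.inl rfl
  mul_mem' := by
    rintro Y Z (rfl | hY) (rfl | hZ)
    · simp
    · simp [hZ]
    · simp [hY]
    · exact Or.inr (hY.mul hZ)

theorem hasPowerJoins_submonoid (T : Type*) [Semigroup T] {J : Set ℕ} (hJ : J.Nonempty) :
    HasPowerJoins J (submonoid T J) := by
  rintro ⟨Z, hZ⟩
  have biUnion_mem : ⋃ j ∈ J, Z ^ j ∈ submonoid T J := by
    rcases hZ with rfl | hZ
    · simp only [one_pow]
      exact Or.inl (Set.biUnion_const hJ _)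
    · exact Or.inr hZ.biUnion_pow
  refine ⟨⟨_, biUnion_mem⟩, ?_⟩
  rintro ⟨X, hX⟩ ⟨Y, hY⟩ ⟨W, hW⟩
  rw [Set.forall_mem_image]
  change X * (⋃ j ∈ J, Z ^ j) * Y ⊆ W ↔ ∀ j ∈ J, X * Z ^ j * Y ⊆ W
  simp only [Set.mul_iUnion, Set.iUnion_mul, Set.iUnion_subset_iff]

end PowerSaturation

instance mulLeftMono_submonoid {M : Type*} [Monoid M] [Preorder M] [MulLeftMono M]
    (N : Submonoid M) : MulLeftMono N where
  elim x _ _ h := mul_le_mul_right (α := M) h x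

instance mulRightMono_submonoid {M : Type*} [Monoid M] [Preorder M] [MulRightMono M]
    (N : Submonoid M) : MulRightMono N where
  elim x _ _ h := mul_le_mul_left (α := M) h x

section Characterization

variable {π : Set ℕ} [DecidablePred (· ∈ π)] {T : Type u} [Semigroup T]

theorem coe_lift_eq_singleton {N : Submonoid (Set (WithOne T))} {β : T → N}
    (hβ : ∀ t, (β t : Set (WithOne T)) = {(t : WithOne T)}) (w : FreeSemigroup T) :
    (FreeSemigroup.lift β w : Set (WithOne T)) = {((FreeSemigroup.lift id w : T) : WithOne T)} := by
  induction w using FreeSemigroup.recOnMul with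
  | ih1 t => exact hβ t
  | ih2 t w _ hw => simp [hw, hβ]

theorem IsPointlike.exists_powerSaturation [Finite T] (hπ : ∀ p ∈ π, p.Prime) (k : ℕ) {Z : Set T}
    (hZ : IsPointlike (fun S _ => SubgroupsArePiGroups π S) Z) :
    ∃ Y, PowerSaturation (largeMultiples (piExponent π k) k) Y ∧ ∀ t ∈ Z, (t : WithOne T) ∈ Y := by
  set J := largeMultiples (piExponent π k) k
  let β (t : T) : PowerSaturation.submonoid T J :=
    ⟨{(t : WithOne T)}, Or.inr (.singleton t)⟩
  have coe_lift := coe_lift_eq_singleton (β := β) fun _ => rfl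
  have nonempty : J.Nonempty := Set.nonempty_Ici.image _
  obtain ⟨C⟩ := nonempty_cycleFreeCover (fun _ => coprime_piExponent hπ k)
    (PowerSaturation.hasPowerJoins_submonoid T nonempty) β
  obtain ⟨x, ⟨w, hw⟩, hx⟩ := hZ.exists_forall_mem_lift_le_label C
  have coe_mem {v} (hv : FreeSemigroup.lift β v ≤ C.label x) :
      ((FreeSemigroup.lift id v : T) : WithOne T) ∈ (C.label x).1 :=
    (coe_lift v ▸ Subtype.coe_le_coe.2 hv) rfl
  refine ⟨C.label x, (C.label x).2.resolve_left fun label_eq_one => ?_, fun t ht => ?_⟩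
  · exact WithOne.coe_ne_one (Set.mem_one.1 (label_eq_one ▸ coe_mem hw))
  · obtain ⟨v, rfl, hv⟩ := hx t ht
    exact coe_mem hv

theorem isPointlike_iff_exists_powerSaturation [Finite T] (hπ : ∀ p ∈ π, p.Prime) {k : ℕ}
    (hk : Nat.card (Set (WithOne T)) ≤ k) {Z : Set T} :
    IsPointlike (fun S _ => SubgroupsArePiGroups π S) Z ↔
      ∃ Y, PowerSaturation (largeMultiples (piExponent π k) k) Y ∧
        ∀ t ∈ Z, (t : WithOne T) ∈ Y :=
  ⟨fun hZ => hZ.exists_powerSaturation hπ k, fun ⟨_, hY, hZY⟩ => hY.isPointlike hπ hk hZY⟩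

end Characterization

/-! ### The algorithm -/

section Iteration

/-- One round of adding to a family of sets all products and, for each of its members, the union of
the powers with exponents in `J`. -/
def closeStep {N : Type*} [Monoid N] (J : Set ℕ) (𝒵 : Set (Set N)) : Set (Set N) :=
  𝒵 ∪ Set.image2 (· * ·) 𝒵 𝒵 ∪ (fun Z => ⋃ j ∈ J, Z ^ j) '' 𝒵

theorem subset_closeStep {N : Type*} [Monoid N] (J : Set ℕ) (𝒵 : Set (Set N)) :
    𝒵 ⊆ closeStep J 𝒵 :=
  Set.subset_union_left.trans Set.subset_union_left

theorem apply_iterate_eq_of_card_le {α : Type*} [Finite α] {Φ : Set α → Set α} (h : ∀ s, s ⊆ Φ s)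
    (s : Set α) {k : ℕ} (hk : Nat.card α ≤ k) : Φ (Φ^[k] s) = Φ^[k] s := by
  by_contra hne
  have ne_of_le (j) (hjk : j ≤ k) : Φ (Φ^[j] s) ≠ Φ^[j] s := by
    intro hj
    obtain ⟨l, rfl⟩ := Nat.exists_eq_add_of_le' hjk
    rw [Function.iterate_add_apply, Function.iterate_fixed hj, hj] at hne
    exact hne rfl
  have le_ncard (j) (hjk : j ≤ k + 1) : j ≤ (Φ^[j] s).ncard := by
    induction j with
    | zero => exact Nat.zero_le _
    | succ j ih =>
      refine (ih (by omega)).trans_lt ?_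
      rw [Function.iterate_succ_apply']
      exact Set.ncard_lt_ncard ((h _).ssubset_of_ne (ne_of_le j (by omega)).symm) (Set.toFinite _)
  have := (le_ncard (k + 1) le_rfl).trans (Set.ncard_le_card _)
  omega

theorem iterate_closeStep_range_singleton {T : Type*} [Semigroup T] [Finite T] (J : Set ℕ) {k : ℕ}
    (hk : Nat.card (Set (WithOne T)) ≤ k) :
    (closeStep J)^[k] (Set.range fun t : T => {(t : WithOne T)}) = {Y | PowerSaturation J Y} := by
  set 𝒵₀ : Set (Set (WithOne T)) := Set.range fun t : T => {(t : WithOne T)}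
  apply Set.Subset.antisymm
  · have closeStep_subset {𝒵 : Set (Set (WithOne T))} (h : 𝒵 ⊆ {Y | PowerSaturation J Y}) :
        closeStep J 𝒵 ⊆ {Y | PowerSaturation J Y} := by
      rintro _ ((hY | ⟨Y, hY, Z, hZ, rfl⟩) | ⟨Z, hZ, rfl⟩)
      exacts [h hY, (h hY).mul (h hZ), (h hZ).biUnion_pow]
    refine Function.Iterate.rec (· ⊆ {Y | PowerSaturation J Y}) ?_ (fun _ => closeStep_subset) k
    rintro _ ⟨t, rfl⟩
    exact .singleton t
  · have closed := apply_iterate_eq_of_card_le (subset_closeStep J) 𝒵₀ hk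
    intro Y hY
    induction hY with
    | singleton t =>
      have subset := Function.Iterate.rec (𝒵₀ ⊆ ·) subset_rfl
        (fun _ h => h.trans (subset_closeStep J _)) k
      exact subset ⟨t, rfl⟩
    | mul _ _ ihY ihZ => exact closed ▸ Or.inl (Or.inr ⟨_, ihY, _, ihZ, rfl⟩)
    | biUnion_pow _ ih => exact closed ▸ Or.inr ⟨_, ih, rfl⟩

end Iteration

section Lists

/-- The set of all products of an element of `a` and an element of `b`, for sets of indices
represented by lists and with products read off the multiplication table `tb`. -/
def listMul (tb : List (List ℕ)) (a b : List ℕ) : List ℕ :=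
  a.flatMap fun i => b.filterMap fun j => tb[i]?.bind (·[j]?)

/-- The `n`-th power of a set of indices, for `n ≠ 0`. -/
def listPow (tb : List (List ℕ)) (a : List ℕ) (n : ℕ) : List ℕ :=
  (fun b => listMul tb b a)^[n - 1] a

/-- The union of the powers of a set of indices with exponents in `largeMultiples D k`, of which
the first `k` are enough. -/
def listUnionPow (tb : List (List ℕ)) (D k : ℕ) (a : List ℕ) : List ℕ :=
  (List.range k).flatMap fun i => listPow tb a (D * (k + i))

/-- The counterpart of `closeStep` for lists of sets of indices. -/
def listStep (tb : List (List ℕ)) (D k : ℕ) (L : List (List ℕ)) : List (List ℕ) :=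
  L ++ (L.flatMap fun a => L.map fun b => listMul tb a b) ++ L.map fun a => listUnionPow tb D k a

/-- The members of `PowerSaturation (largeMultiples D k)` as lists of indices. -/
def listFamily (tb : List (List ℕ)) (D k : ℕ) : List (List ℕ) :=
  (listStep tb D k)^[k] ((List.range tb.length).map fun i => [i])

/-- The increasing lists of indices that are contained in a member of `listFamily tb D k`. -/
def listBelowFamily (tb : List (List ℕ)) (D k : ℕ) : List (List ℕ) :=
  (List.range tb.length).sublists.filter fun l => ∃ a ∈ listFamily tb D k, l ⊆ a

/-- The number of sets of elements of `WithOne T`, for a semigroup `T` with multiplication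
table `tb`. -/
def setCount (tb : List (List ℕ)) : ℕ := 2 ^ (tb.length + 1)

/-- The list of all pointlike sets of the semigroup with multiplication table `tb`. -/
def pointlikeLists (π : Set ℕ) [DecidablePred (· ∈ π)] (tb : List (List ℕ)) : List (List ℕ) :=
  listBelowFamily tb (piExponent π (setCount tb)) (setCount tb)

end Lists

section Computability

variable {α : Type*} [Primcodable α] {tb : α → List (List ℕ)}

theorem primrec_listMul {a b : α → List ℕ} (htb : Primrec tb) (ha : Primrec a) (hb : Primrec b) :
    Primrec fun x => listMul (tb x) (a x) (b x) := by
  have entry : Primrec fun q : (α × ℕ) × ℕ => (tb q.1.1)[q.1.2]?.bind (·[q.2]?) :=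
    Primrec.option_bind
      (Primrec.list_getElem?.comp (htb.comp (Primrec.fst.comp .fst)) (Primrec.snd.comp .fst))
      (Primrec.list_getElem?.comp .snd (Primrec.snd.comp .fst))
  exact Primrec.list_flatMap ha (Primrec.listFilterMap (hb.comp .fst) entry.to₂).to₂

theorem primrec_listPow {a : α → List ℕ} {n : α → ℕ} (htb : Primrec tb) (ha : Primrec a)
    (hn : Primrec n) : Primrec fun x => listPow (tb x) (a x) (n x) :=
  Primrec.nat_iterate (Primrec.pred.comp hn) ha
    (primrec_listMul (htb.comp .fst) .snd (ha.comp .fst)).to₂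

theorem primrec_listUnionPow {D k : α → ℕ} {a : α → List ℕ} (htb : Primrec tb) (hD : Primrec D)
    (hk : Primrec k) (ha : Primrec a) :
    Primrec fun x => listUnionPow (tb x) (D x) (k x) (a x) := by
  have exponent : Primrec fun q : α × ℕ => D q.1 * (k q.1 + q.2) :=
    Primrec.nat_mul.comp (hD.comp .fst) (Primrec.nat_add.comp (hk.comp .fst) .snd)
  exact Primrec.list_flatMap (Primrec.list_range.comp hk)
    (primrec_listPow (htb.comp .fst) (ha.comp .fst) exponent).to₂

theorem primrec_listStep {D k : α → ℕ} {L : α → List (List ℕ)} (htb : Primrec tb) (hD : Primrec D)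
    (hk : Primrec k) (hL : Primrec L) :
    Primrec fun x => listStep (tb x) (D x) (k x) (L x) := by
  have products : Primrec fun x => (L x).flatMap fun a => (L x).map fun b => listMul (tb x) a b :=
    Primrec.list_flatMap hL <| Primrec.to₂ <| Primrec.list_map (hL.comp .fst) <| Primrec.to₂ <|
      primrec_listMul (htb.comp (Primrec.fst.comp .fst)) (Primrec.snd.comp .fst) .snd
  have unions : Primrec fun x => (L x).map fun a => listUnionPow (tb x) (D x) (k x) a :=
    Primrec.list_map hL <| Primrec.to₂ <|
      primrec_listUnionPow (htb.comp .fst) (hD.comp .fst) (hk.comp .fst) .snd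
  exact Primrec.list_append.comp (Primrec.list_append.comp hL products) unions

theorem primrec_listFamily {D k : α → ℕ} (htb : Primrec tb) (hD : Primrec D) (hk : Primrec k) :
    Primrec fun x => listFamily (tb x) (D x) (k x) := by
  have singletons : Primrec fun x => (List.range (tb x).length).map fun i => [i] :=
    Primrec.list_map (Primrec.list_range.comp (Primrec.list_length.comp htb)) <| Primrec.to₂ <|
      Primrec.list_cons.comp .snd (.const [])
  exact Primrec.nat_iterate hk singletons
    (primrec_listStep (htb.comp .fst) (hD.comp .fst) (hk.comp .fst) .snd).to₂

theorem primrec_sublists_range : Primrec fun n => (List.range n).sublists := by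
  have step : Primrec₂ fun (n : ℕ) (L : List (List ℕ)) => L ++ L.map fun l => l ++ [n] :=
    Primrec.list_append.comp .snd <| Primrec.list_map .snd <|
      Primrec.list_concat.comp .snd (Primrec.fst.comp .fst)
  refine (Primrec.nat_rec₁ [[]] step).of_eq fun n => ?_
  induction n with
  | zero => rfl
  | succ n ih =>
    rw [List.range_succ, List.sublists_concat, ← ih]

theorem primrecRel_subset : PrimrecRel fun l a : List ℕ => l ⊆ a := by
  have mem : PrimrecRel fun (i : ℕ) (a : List ℕ) => i ∈ a :=
    (PrimrecRel.exists_mem_list Primrec.eq).swap.of_eq fun i a => by simp [Function.swap]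
  exact mem.forall_mem_list

theorem primrec_listBelowFamily {D k : α → ℕ} (htb : Primrec tb) (hD : Primrec D)
    (hk : Primrec k) : Primrec fun x => listBelowFamily (tb x) (D x) (k x) := by
  have below : PrimrecRel fun (l : List ℕ) (L : List (List ℕ)) => ∃ a ∈ L, l ⊆ a :=
    (PrimrecRel.exists_mem_list primrecRel_subset.swap).swap
  exact below.listFilter.comp (primrec_sublists_range.comp (Primrec.list_length.comp htb))
    (primrec_listFamily htb hD hk)

theorem primrec_pow : Primrec₂ fun a b : ℕ => a ^ b :=
  Primrec₂.unpaired'.1 Nat.Primrec.pow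

theorem primrec_setCount : Primrec setCount :=
  primrec_pow.comp (.const 2) (Primrec.succ.comp .list_length)

variable {π : Set ℕ} [DecidablePred (· ∈ π)]

theorem computable_piExponent (h : Computable fun p => decide (p ∈ π)) :
    Computable (piExponent π) := by
  have step : Computable₂ fun (k : ℕ) (q : ℕ × ℕ) =>
      bif decide (q.1 ∈ π) then q.2 * q.1 ^ k else q.2 :=
    Computable.cond (h.comp (Computable.fst.comp .snd))
      (Primrec.to_comp (Primrec.nat_mul.comp (Primrec.snd.comp .snd)
        (primrec_pow.comp (Primrec.fst.comp .snd) .fst)))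
      (Computable.snd.comp .snd)
  refine (Computable.nat_rec Computable.succ (Computable.const 1) step).of_eq fun k => ?_
  rw [piExponent, Finset.prod_filter, ← Nat.succ_eq_add_one]
  generalize k.succ = n
  induction n with
  | zero => rfl
  | succ n ih =>
    rw [Finset.prod_range_succ, ← ih]
    by_cases hn : n ∈ π <;> simp [hn]

theorem computable_pointlikeLists (h : Computable fun p => decide (p ∈ π)) :
    Computable (pointlikeLists π) := by
  have below : Primrec₂ fun tb D => listBelowFamily tb D (setCount tb) :=
    primrec_listBelowFamily .fst .snd (primrec_setCount.comp .fst)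
  exact below.to_comp.comp .id ((computable_piExponent h).comp primrec_setCount.to_comp)

end Computability

section Correctness

variable {T : Type u} {n : ℕ} (e : Fin n ≃ T)

/-- The set of the elements of `T` whose indices occur in the list `a`. -/
def decode (a : List ℕ) : Set (WithOne T) :=
  (fun i => (e i : WithOne T)) '' {i : Fin n | (i : ℕ) ∈ a}

theorem coe_mem_decode {a : List ℕ} {i : Fin n} : (e i : WithOne T) ∈ decode e a ↔ (i : ℕ) ∈ a :=
  (WithOne.coe_injective.comp e.injective).mem_set_image

theorem decode_flatMap (L : List ℕ) (f : ℕ → List ℕ) :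
    decode e (L.flatMap f) = ⋃ i ∈ L, decode e (f i) := by
  simp only [decode, ← Set.image_iUnion, List.mem_flatMap]
  congr 1
  ext i
  simp

theorem decode_singleton (i : Fin n) : decode e [(i : ℕ)] = {(e i : WithOne T)} := by
  simp [decode, Fin.val_inj]

theorem val_mem_indexList {Z : Set T} {i : Fin n} : (i : ℕ) ∈ indexList e Z ↔ e i ∈ Z := by
  simp [indexList, Fin.val_inj]

theorem indexList_sublist_range (Z : Set T) : (indexList e Z).Sublist (List.range n) := by
  rw [← List.map_coe_finRange_eq_range]
  exact List.filter_sublist.map _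

theorem indexList_subset_iff (Z : Set T) (a : List ℕ) :
    indexList e Z ⊆ a ↔ ∀ t ∈ Z, (t : WithOne T) ∈ decode e a := by
  refine ⟨fun h => e.surjective.forall.2 fun i hi =>
    (coe_mem_decode e).2 (h ((val_mem_indexList e).2 hi)), fun h i hi => ?_⟩
  have hin : i < n := List.mem_range.1 ((indexList_sublist_range e Z).subset hi)
  exact (coe_mem_decode e (i := ⟨i, hin⟩)).1 (h _ ((val_mem_indexList e (i := ⟨i, hin⟩)).1 hi))

theorem exists_indexList_eq_iff (l : List ℕ) :
    (∃ Z, indexList e Z = l) ↔ l ∈ (List.range n).sublists := by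
  rw [List.mem_sublists]
  refine ⟨fun ⟨Z, hZ⟩ => hZ ▸ indexList_sublist_range e Z, fun hl => ?_⟩
  refine ⟨e '' {i | (i : ℕ) ∈ l}, ?_⟩
  have sorted_of_sublist {l' : List ℕ} (h : l'.Sublist (List.range n)) : l'.Pairwise (· < ·) :=
    List.pairwise_lt_range.sublist h
  refine (sorted_of_sublist (indexList_sublist_range e _)).eq_of_mem_iff (sorted_of_sublist hl)
    fun i => ?_
  by_cases hin : i < n
  · rw [val_mem_indexList e (i := ⟨i, hin⟩), e.injective.mem_set_image, Set.mem_ofPred_eq]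
  · exact iff_of_false (fun h => hin (List.mem_range.1 ((indexList_sublist_range e _).subset h)))
      fun h => hin (List.mem_range.1 (hl.subset h))

variable [Semigroup T]

theorem length_mulTable : (mulTable e).length = n := by
  simp [mulTable]

theorem mulTable_entry_eq_some_iff {i j m : ℕ} :
    (mulTable e)[i]?.bind (·[j]?) = some m ↔
      ∃ (hi : i < n) (hj : j < n), (e.symm (e ⟨i, hi⟩ * e ⟨j, hj⟩) : ℕ) = m := by
  by_cases hi : i < n <;> by_cases hj : j < n <;> simp [mulTable, hi, hj]

theorem decode_listMul (a b : List ℕ) :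
    decode e (listMul (mulTable e) a b) = decode e a * decode e b := by
  ext x
  simp only [decode, listMul, Set.mem_image, Set.mem_ofPred_eq, List.mem_flatMap,
    List.mem_filterMap, mulTable_entry_eq_some_iff, Set.mem_mul]
  constructor
  · rintro ⟨m, ⟨i, hia, j, hjb, hi, hj, hm⟩, rfl⟩
    refine ⟨_, ⟨⟨i, hi⟩, hia, rfl⟩, _, ⟨⟨j, hj⟩, hjb, rfl⟩, ?_⟩
    rw [← Fin.ext hm, e.apply_symm_apply, WithOne.coe_mul]
  · rintro ⟨_, ⟨i, hia, rfl⟩, _, ⟨j, hjb, rfl⟩, rfl⟩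
    refine ⟨e.symm (e i * e j), ⟨i, hia, j, hjb, i.2, j.2, rfl⟩, ?_⟩
    rw [e.apply_symm_apply, WithOne.coe_mul]

theorem decode_listPow (a : List ℕ) {m : ℕ} (hm : m ≠ 0) :
    decode e (listPow (mulTable e) a m) = decode e a ^ m := by
  have semiconj : Function.Semiconj (decode e) (fun b => listMul (mulTable e) b a)
      (· * decode e a) := fun b => decode_listMul e b a
  rw [listPow, semiconj.iterate_right (m - 1) a, mul_right_iterate]
  exact mul_pow_sub_one hm _

theorem decode_listUnionPow {D k : ℕ} (hD : D ≠ 0) (hk : Nat.card (Set (WithOne T)) ≤ k)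
    (a : List ℕ) : decode e (listUnionPow (mulTable e) D k a) =
      ⋃ j ∈ largeMultiples D k, decode e a ^ j := by
  have := Finite.of_equiv _ e
  have hk₀ : k ≠ 0 := (Nat.card_pos.trans_le hk).ne'
  have powers := congrArg Set.sUnion (image_pow_largeMultiples_eq_image_Iio hk D (decode e a))
  simp only [Set.sUnion_image] at powers
  have exponent_ne_zero (i : ℕ) : D * (k + i) ≠ 0 := Nat.mul_ne_zero hD (by omega)
  simp only [listUnionPow, decode_flatMap, powers, decode_listPow e a (exponent_ne_zero _),
    List.mem_range, Set.mem_Iio]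

theorem image_decode_listStep {D k : ℕ} (hD : D ≠ 0) (hk : Nat.card (Set (WithOne T)) ≤ k)
    (L : List (List ℕ)) : decode e '' {a | a ∈ listStep (mulTable e) D k L} =
      closeStep (largeMultiples D k) (decode e '' {a | a ∈ L}) := by
  have products : {c | c ∈ L.flatMap fun a => L.map fun b => listMul (mulTable e) a b} =
      Set.image2 (listMul (mulTable e)) {a | a ∈ L} {b | b ∈ L} := by
    ext c
    simp [Set.mem_image2]
  have unions : {c | c ∈ L.map fun a => listUnionPow (mulTable e) D k a} =
      listUnionPow (mulTable e) D k '' {a | a ∈ L} := by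
    ext c
    simp
  simp only [listStep, List.mem_append, Set.ofPred_or, products, unions, Set.image_union,
    closeStep, Set.image_image2, Set.image2_image_left, Set.image2_image_right, Set.image_image,
    decode_listMul, decode_listUnionPow e hD hk]

theorem image_decode_listFamily {D k : ℕ} (hD : D ≠ 0) (hk : Nat.card (Set (WithOne T)) ≤ k) :
    decode e '' {a | a ∈ listFamily (mulTable e) D k} =
      {Y | PowerSaturation (largeMultiples D k) Y} := by
  have := Finite.of_equiv _ e
  have semiconj : Function.Semiconj (fun L => decode e '' {a | a ∈ L})
      (listStep (mulTable e) D k) (closeStep (largeMultiples D k)) :=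
    image_decode_listStep e hD hk
  have singletons : decode e '' {a | a ∈ (List.range n).map fun i => [i]} =
      Set.range fun t : T => {(t : WithOne T)} := by
    ext Y
    simp [e.surjective.exists, ← decode_singleton, Fin.exists_iff]
  rw [listFamily, length_mulTable, ← iterate_closeStep_range_singleton _ hk, ← singletons]
  exact semiconj.iterate_right k _

theorem natCard_set_withOne : Nat.card (Set (WithOne T)) = setCount (mulTable e) := by
  have := Finite.of_equiv _ e
  have : Nat.card (WithOne T) = n + 1 := by
    rw [← Nat.card_fin n, Nat.card_congr e]
    exact Finite.card_option
  rw [setCount, length_mulTable, ← this]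
  have := Fintype.ofFinite (WithOne T)
  simp

theorem isPointlike_iff_exists_indexList_subset {π : Set ℕ} [DecidablePred (· ∈ π)]
    (hπ : ∀ p ∈ π, p.Prime) {k : ℕ} (hk : Nat.card (Set (WithOne T)) ≤ k) {Z : Set T} :
    IsPointlike (fun S _ => SubgroupsArePiGroups π S) Z ↔
      ∃ a ∈ listFamily (mulTable e) (piExponent π k) k, indexList e Z ⊆ a := by
  have := Finite.of_equiv _ e
  have mem_family (Y : Set (WithOne T)) : PowerSaturation (largeMultiples (piExponent π k) k) Y ↔
      ∃ a ∈ listFamily (mulTable e) (piExponent π k) k, decode e a = Y :=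
    (Set.ext_iff.1 (image_decode_listFamily e (piExponent_ne_zero hπ k) hk) Y).symm
  rw [isPointlike_iff_exists_powerSaturation hπ hk]
  simp only [mem_family, indexList_subset_iff, exists_exists_and_eq_and]

theorem mem_pointlikeLists_iff {π : Set ℕ} [DecidablePred (· ∈ π)] (hπ : ∀ p ∈ π, p.Prime)
    (l : List ℕ) : l ∈ pointlikeLists π (mulTable e) ↔
      ∃ Z : Set T, IsPointlike (fun S _ => SubgroupsArePiGroups π S) Z ∧ indexList e Z = l := by
  simp only [isPointlike_iff_exists_indexList_subset e hπ (natCard_set_withOne e).le,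
    pointlikeLists, listBelowFamily, length_mulTable, List.mem_filter, decide_eq_true_eq,
    ← exists_indexList_eq_iff e]
  constructor
  · rintro ⟨⟨Z, rfl⟩, below⟩
    exact ⟨Z, below, rfl⟩
  · rintro ⟨Z, below, rfl⟩
    exact ⟨⟨Z, rfl⟩, below⟩

end Correctness

theorem mainTheorem2 (π : Set ℕ) (hπ : ∀ p ∈ π, p.Prime)
    (hrec : ComputablePred fun p : ℕ => p ∈ π) :
    ∃ F : List (List ℕ) → List (List ℕ), Computable F ∧
      ∀ (T : Type*) [Semigroup T] (n : ℕ) (e : Fin n ≃ T) (l : List ℕ),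
        l ∈ F (mulTable e) ↔
          ∃ Z : Set T, IsPointlike (fun S _ => SubgroupsArePiGroups π S) Z ∧ indexList e Z = l := by
  obtain ⟨_, hdec⟩ := hrec
  exact ⟨pointlikeLists π, computable_pointlikeLists hdec,
    fun T _ n e l => mem_pointlikeLists_iff e hπ l⟩
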